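/- Let $\mathfrak A$ be a (complex, not necessarily unital) Banach $^*$-algebra with continuous involution which is a $^*$-subalgebra of a $C^*$-algebra $\mathfrak B$ (the norms of $\mathfrak A$ and $\mathfrak B$ may differ). Let $k\ge 2$ be an integer and let $p,q>0$ be real numbers with $p+q=k$. Suppose that $\mathfrak A$ is a $(k,p,q)$-differential subalgebra of $\mathfrak B$, i.e. there is a constant $C>0$ such that $$\|a^k\|_{\mathfrak A}\le C\,\|a\|_{\mathfrak A}^{p}\,\|a\|_{\mathfrak B}^{q}\qquad\text{for all } a\in\mathfrak A .$$ For $a\in\mathfrak A$ let $\mathfrak A(a)$ be the closed (not necessarily unital) subalgebra of $\mathfrak A$ generated by $a$. Then $\mathfrak A$ is locally regular: $\mathfrak A$ is reduced (its $^*$-representations on Hilbert spaces separate its points) and there is a dense subset $R$ of the set $\mathfrak A_{\rm sa}$ of self-adjoint elements such that $\mathfrak A(a)$ is regular for all $a\in R$. Indeed, $\mathfrak A(a)$ is regular for every $a\in\mathfrak A_{\rm sa}$. Here a commutative Banach algebra $\mathfrak C$ with spectrum $\Delta$ (its nonzero continuous multiplicative linear functionals, with the weak-$*$ topology) is called regular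 if it is semisimple and for every closed $X\subset\Delta$ and every $\omega\in\Delta\setminus X$ there is $c\in\mathfrak C$ whose Gelfand transform satisfies $\hat c|_X=0$ and $\hat c(\omega)\ne 0$. -/

import Mathlib

universe u

namespace DiffSubalg

/-- Positive powers `a ^ n` (`n ≥ 1`) in a ring without unit; the value at `n = 0` is never used. -/
def posPow {R : Type u} [NonUnitalRing R] (a : R) : ℕ → R
  | 0 => 0
  | 1 => a
  | n + 2 => posPow a (n + 1) * a

/-- In a unital ring `posPow` is the usual power. -/
theorem posPow_eq_pow {R : Type u} [Ring R] (a : R) (n : ℕ) : posPow a (n + 1) = a ^ (n + 1) := by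
  induction n with
  | zero => simp [posPow]
  | succ n ih => rw [posPow, ih, ← pow_succ]

/-- A subalgebra of a complex normed algebra carries the restricted norm. -/
instance subalgebraNormedSpace {A : Type u} [NonUnitalNormedRing A] [NormedSpace ℂ A]
    (S : NonUnitalSubalgebra ℂ A) : NormedSpace ℂ S where
  norm_smul_le c x := norm_smul_le c (x : A)

section Banach

variable (R : Type u) [NonUnitalNormedRing R] [NormedSpace ℂ R] [IsScalarTower ℂ R R]
  [SMulCommClass ℂ R R]

/-- A regular semisimple commutative Banach algebra (with or without unit). `characterSpace ℂ R` is
the Gelfand spectrum: the nonzero continuous multiplicative functionals with the weak-* topology. -/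
structure IsRegularBanachAlgebra : Prop where
  complete : CompleteSpace R
  comm : ∀ x y : R, x * y = y * x
  /-- Semisimplicity: the Gelfand transform is injective. -/
  semisimple : ∀ x : R, (∀ φ : WeakDual.characterSpace ℂ R, φ x = 0) → x = 0
  /-- Points of the spectrum are separated from closed sets by Gelfand transforms. -/
  separates : ∀ X : Set (WeakDual.characterSpace ℂ R), IsClosed X →
    ∀ ω : WeakDual.characterSpace ℂ R, ω ∉ X → ∃ x : R, (∀ φ ∈ X, φ x = 0) ∧ ω x ≠ 0

end Banach

section BanachStar

variable (A : Type u) [NonUnitalNormedRing A] [NormedSpace ℂ A] [IsScalarTower ℂ A A]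
  [SMulCommClass ℂ A A] [CompleteSpace A] [StarRing A] [StarModule ℂ A]

/-- A `*`-algebra is reduced if its `*`-representations by bounded operators on Hilbert spaces
separate its points. -/
def IsReducedStarAlgebra : Prop :=
  ∀ a : A, a ≠ 0 → ∃ (H : Type u) (_ : NormedAddCommGroup H) (_ : InnerProductSpace ℂ H)
    (_ : CompleteSpace H) (π : A →⋆ₙₐ[ℂ] (H →L[ℂ] H)), π a ≠ 0

/-- Local regularity: `A` is reduced and there is a set `S` of self-adjoint elements, dense in the
set of all self-adjoint elements, such that for every `a ∈ S` the closed (not necessarily unital)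
subalgebra generated by `a` is a regular commutative Banach algebra. -/
structure IsLocallyRegular : Prop where
  reduced : IsReducedStarAlgebra A
  exists_dense : ∃ S : Set A, S ⊆ {a : A | IsSelfAdjoint a} ∧ {a : A | IsSelfAdjoint a} ⊆ closure S ∧
    ∀ a ∈ S, IsRegularBanachAlgebra (NonUnitalAlgebra.elemental ℂ a)

variable {A}
variable {B : Type u} [NonUnitalCStarAlgebra B]

/-- `A`, regarded as a `*`-subalgebra of the C*-algebra `B` through the injective `*`-homomorphism
`ι`, is a `(k, p, q)`-differential subalgebra of `B`. -/
structure IsDifferentialSubalgebra (k : ℕ) (p q : ℝ) (ι : A →⋆ₙₐ[ℂ] B) : Prop where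
  injective : Function.Injective ι
  continuous_star : Continuous (star : A → A)
  two_le : 2 ≤ k
  p_pos : 0 < p
  q_pos : 0 < q
  add_eq : p + q = k
  bound : ∃ C : ℝ, 0 < C ∧ ∀ a : A, ‖posPow a k‖ ≤ C * ‖a‖ ^ p * ‖ι a‖ ^ q

end BanachStar

end DiffSubalg

/-!
Let `a` be a self-adjoint element, `E` the closed subalgebra it generates, and
`u(t) = exp (2π i t a)`, an element of the `ℓ¹`-unitization of `E`, so that `u(t) - 1` lies in `E`.

*Growth.* The image of `u(t)` in the unitization of the C*-algebra is unitary, so the differential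
inequality, applied to `u(t) - 1`, reads `‖(u(t) - 1) ^ k‖ ≤ C' ‖u(t) - 1‖ ^ p` with `p < k`. The
binomial expansion of `(u(t) - 1) ^ k` consists of `u(t) ^ k = u(k t)` and of powers of `u(t)` with
exponent at most `k - 1`; hence `‖u(k t)‖ ≤ K ‖u(t)‖ ^ m` for some `m < k`. Iterating this gives
`‖u(t)‖ ≤ exp (c + c |t| ^ γ)` with `γ < 1` (`exists_norm_unitizationExp_le`).

*Local elements.* Weights of this kind are non-quasianalytic: some function `w` is integrable
against the weight and has a Fourier transform equal to `1` at the origin and supported near it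
(`exists_weighted_integrable_fourier_bump`). Such a `w` is the Fourier transform of a smooth bump
function times an infinite product of cardinal sines, that is, the transform of the bump function
convolved with infinitely many uniform distributions. For a character `ω`, integrating
`w(t) exp (-2π i t ω(a)) (u(t) - 1)` produces an element of `E` whose Gelfand transform at `φ` is
the bump function at `φ(a) - ω(a)`, provided the support is too small to reach the point
`-ω(a)`, where the term `-1` would contribute; the growth bound also forces `φ(a)` to be real.
Since the topology of the spectrum of `E` is induced by `φ ↦ φ(a)`, these elements separate points
from closed sets.

*Semisimplicity.* If all characters vanish at `x ∈ E`, the spectrum of `x` in the unitization is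
`{0}`. The image of `x` in the C*-algebra is normal, so its norm is its spectral radius, which
is `0`.

*Reducedness.* A C*-algebra has enough positive functionals by Hahn–Banach separation from the
closed cone of positive elements, and the GNS representations they define separate points.
-/

/-! ### Test functions for non-quasianalytic weights -/

section

open MeasureTheory Real Filter Topology

/-- The cardinal sine is the average of the characters `s ↦ exp (i y s)` over `[-1, 1]`. -/
theorem ofReal_sinc_eq_integral (y : ℝ) :
    ((sinc y : ℝ) : ℂ) = (1 / 2) * ∫ s in (-1 : ℝ)..1, Complex.exp (↑(y * s) * Complex.I) := by
  by_cases hy : y = 0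
  · subst hy
    simp
    norm_num
  · have hc : (y : ℂ) * Complex.I ≠ 0 := by simp [hy]
    have h := integral_exp_mul_complex (a := -1) (b := 1) hc
    have h2 : ∀ s : ℝ, Complex.exp (↑(y * s) * Complex.I) = Complex.exp (↑y * Complex.I * s) := by
      intro s; congr 1; push_cast; ring
    simp_rw [h2]
    rw [h, sinc_of_ne_zero hy]
    have e1 : Complex.exp (y * Complex.I * ((1 : ℝ) : ℂ)) =
        Complex.cos y + Complex.sin y * Complex.I := by
      rw [← Complex.exp_mul_I]; simp
    have e2 : Complex.exp (y * Complex.I * ((-1 : ℝ) : ℂ)) =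
        Complex.cos y - Complex.sin y * Complex.I := by
      have := Complex.exp_mul_I (-(y : ℂ))
      rw [Complex.cos_neg, Complex.sin_neg] at this
      rw [sub_eq_add_neg, ← neg_mul, ← this]; congr 1; push_cast; ring
    have hy' : (y : ℂ) ≠ 0 := by exact_mod_cast hy
    rw [e1, e2]
    push_cast
    field_simp
    ring

theorem abs_sinc_sub_one_le (y : ℝ) : |sinc y - 1| ≤ |y| := by
  have h : ((sinc y - 1 : ℝ) : ℂ) =
      (1 / 2) * ∫ s in (-1 : ℝ)..1, (Complex.exp (↑(y * s) * Complex.I) - 1) := by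
    rw [intervalIntegral.integral_sub (by apply Continuous.intervalIntegrable; fun_prop) (by simp)]
    push_cast
    rw [ofReal_sinc_eq_integral y, mul_sub]
    simp
    norm_num
  have h2 : ‖∫ s in (-1 : ℝ)..1, (Complex.exp (↑(y * s) * Complex.I) - 1)‖ ≤
      |y| * |1 - (-1 : ℝ)| := by
    apply intervalIntegral.norm_integral_le_of_norm_le_const
    intro s hs
    rw [Set.uIoc_of_le (by norm_num)] at hs
    have := Real.norm_exp_I_mul_ofReal_sub_one_le (x := y * s)
    rw [mul_comm Complex.I] at this
    refine this.trans ?_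
    rw [norm_mul, norm_eq_abs, norm_eq_abs]
    have : |s| ≤ 1 := abs_le.2 ⟨hs.1.le, hs.2⟩
    nlinarith [abs_nonneg y]
  rw [← Complex.norm_real (sinc y - 1) |>.trans (norm_eq_abs _), h, norm_mul]
  norm_num at h2 ⊢
  linarith

theorem abs_sinc_le_half {y : ℝ} (hy : 2 ≤ |y|) : |sinc y| ≤ 1 / 2 := by
  have h0 : y ≠ 0 := by rintro rfl; norm_num at hy
  rw [sinc_of_ne_zero h0, abs_div, div_le_iff₀ (by linarith)]
  have := abs_sin_le_one y
  linarith

/-- Multiplying `P` by a cardinal sine averages its Fourier transform over an interval of radius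
`a`, so it keeps the value of the transform where that is constant on such an interval. -/
theorem integral_mul_sinc_mul_exp {P : ℝ → ℂ} (hP : Integrable P) {a x : ℝ} (ha : 0 ≤ a) {z : ℂ}
    (h : ∀ y, |y - x| ≤ a → ∫ t, P t * Complex.exp (↑(2 * π * (t * y)) * Complex.I) = z) :
    ∫ t, (P t * ((sinc (2 * π * a * t) : ℝ) : ℂ)) *
      Complex.exp (↑(2 * π * (t * x)) * Complex.I) = z := by
  set μ : Measure ℝ := volume.restrict (Set.Ioc (-1) 1)
  have hF : Integrable (fun p : ℝ × ℝ => P p.1 *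
      Complex.exp (↑(2 * π * (p.1 * (x + a * p.2))) * Complex.I)) (volume.prod μ) := by
    refine (hP.comp_fst μ).mul_bdd (c := 1) ?_ ?_
    · apply Continuous.aestronglyMeasurable; fun_prop
    · exact Eventually.of_forall fun p => (Complex.norm_exp_ofReal_mul_I _).le
  have h1 : ∀ t : ℝ, (P t * ((sinc (2 * π * a * t) : ℝ) : ℂ)) *
      Complex.exp (↑(2 * π * (t * x)) * Complex.I) = (1 / 2) * ∫ s, P t *
      Complex.exp (↑(2 * π * (t * (x + a * s))) * Complex.I) ∂μ := by
    intro t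
    rw [ofReal_sinc_eq_integral, intervalIntegral.integral_of_le (by norm_num),
      integral_const_mul]
    have : ∀ s : ℝ, Complex.exp (↑(2 * π * (t * (x + a * s))) * Complex.I) =
        Complex.exp (↑(2 * π * (t * x)) * Complex.I) *
          Complex.exp (↑(2 * π * a * t * s) * Complex.I) := by
      intro s; rw [← Complex.exp_add]; congr 1; push_cast; ring
    simp_rw [this]
    rw [integral_const_mul]
    ring
  simp_rw [h1]
  rw [integral_const_mul, integral_integral_swap hF]
  have h2 : ∫ s, ∫ t, P t * Complex.exp (↑(2 * π * (t * (x + a * s))) * Complex.I) ∂volume ∂μ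
      = ∫ s, z ∂μ := by
    apply integral_congr_ae
    filter_upwards [ae_restrict_mem measurableSet_Ioc] with s hs
    apply h
    rw [add_sub_cancel_left, abs_mul, abs_of_nonneg ha]
    have : |s| ≤ 1 := abs_le.2 ⟨hs.1.le, hs.2⟩
    nlinarith
  rw [h2]
  simp [μ]
  ring

theorem integrable_mul_prod_sinc {P : ℝ → ℂ} (hP : Integrable P) (a : ℕ → ℝ) (N : ℕ) :
    Integrable fun t => P t * ((∏ n ∈ Finset.range N, sinc (2 * π * a n * t) : ℝ) : ℂ) := by
  refine hP.mul_bdd (c := 1) ?_ (Eventually.of_forall fun t => ?_)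
  · apply Continuous.aestronglyMeasurable
    have := continuous_sinc
    fun_prop
  · rw [Complex.norm_real, norm_eq_abs, Finset.abs_prod]
    exact Finset.prod_le_one (fun _ _ => abs_nonneg _) fun _ _ => abs_sinc_le_one _

theorem integral_mul_prod_sinc_mul_exp {P : ℝ → ℂ} (hP : Integrable P) {a : ℕ → ℝ}
    (ha : ∀ n, 0 ≤ a n) (N : ℕ) {x : ℝ} {z : ℂ}
    (h : ∀ y, |y - x| ≤ ∑ n ∈ Finset.range N, a n →
      ∫ t, P t * Complex.exp (↑(2 * π * (t * y)) * Complex.I) = z) :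
    ∫ t, (P t * ((∏ n ∈ Finset.range N, sinc (2 * π * a n * t) : ℝ) : ℂ)) *
      Complex.exp (↑(2 * π * (t * x)) * Complex.I) = z := by
  induction N generalizing x with
  | zero => simpa using h x (by simp)
  | succ N ih =>
    have := integral_mul_sinc_mul_exp (integrable_mul_prod_sinc hP a N) (ha N) (x := x) (z := z) ?_
    · simpa [Finset.prod_range_succ, mul_assoc] using this
    · intro y hy
      refine ih fun y' hy' => h y' ?_
      rw [Finset.sum_range_succ]
      calc |y' - x| = |(y' - y) + (y - x)| := by ring_nf
        _ ≤ _ := abs_add_le _ _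
        _ ≤ _ := by linarith

/-- The infinite product `∏ sinc (2π aₙ t)`, the Fourier transform of an infinite convolution of
uniform distributions. -/
noncomputable def sincProd (a : ℕ → ℝ) (t : ℝ) : ℝ := ∏' n, sinc (2 * π * a n * t)

theorem tendsto_prod_sincProd {a : ℕ → ℝ} (ha : Summable a) (ha0 : ∀ n, 0 ≤ a n) (t : ℝ) :
    Tendsto (fun N => ∏ n ∈ Finset.range N, sinc (2 * π * a n * t)) atTop (𝓝 (sincProd a t)) := by
  have h : Summable fun n => ‖sinc (2 * π * a n * t) - 1‖ := by
    refine Summable.of_nonneg_of_le (fun _ => norm_nonneg _) (fun n => ?_)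
      (ha.mul_left (2 * π * |t|))
    refine (abs_sinc_sub_one_le _).trans (le_of_eq ?_)
    rw [abs_mul, abs_mul, abs_of_nonneg (ha0 n), abs_of_pos (by positivity)]
    ring
  have := (multipliable_one_add_of_summable h).tendsto_prod_tprod_nat
  simpa [sincProd] using this

/-- Each factor with `1 ≤ aₙ |t|` contributes a factor `1 / 2`, so the decay of the product is
governed by the number of such `n`. -/
theorem abs_sincProd_le_pow {a : ℕ → ℝ} (ha : Summable a) (ha0 : ∀ n, 0 ≤ a n) {t : ℝ} {N : ℕ}
    (hN : ∀ n < N, 1 ≤ a n * |t|) : |sincProd a t| ≤ (1 / 2) ^ N := by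
  refine le_of_tendsto (tendsto_prod_sincProd ha ha0 t).abs ?_
  filter_upwards [eventually_ge_atTop N] with M hM
  rw [← Finset.prod_range_mul_prod_Ico _ hM, abs_mul, Finset.abs_prod, Finset.abs_prod]
  have h1 : ∏ n ∈ Finset.range N, |sinc (2 * π * a n * t)| ≤ (1 / 2) ^ N := by
    calc _ ≤ ∏ n ∈ Finset.range N, (1 / 2 : ℝ) := by
          refine Finset.prod_le_prod (fun _ _ => abs_nonneg _) fun n hn => abs_sinc_le_half ?_
          have := hN n (Finset.mem_range.1 hn)
          rw [abs_mul, abs_mul, abs_of_nonneg (ha0 n), abs_of_pos (by positivity)]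
          nlinarith [pi_gt_three]
      _ = _ := by simp
  have h2 : ∏ n ∈ Finset.Ico N M, |sinc (2 * π * a n * t)| ≤ 1 :=
    Finset.prod_le_one (fun _ _ => abs_nonneg _) fun _ _ => abs_sinc_le_one _
  calc _ ≤ (1 / 2 : ℝ) ^ N * 1 := by gcongr
    _ = _ := mul_one _

theorem measurable_sincProd {a : ℕ → ℝ} (ha : Summable a) (ha0 : ∀ n, 0 ≤ a n) :
    Measurable (sincProd a) := by
  refine measurable_of_tendsto_metrizable
    (f := fun N t => ∏ n ∈ Finset.range N, sinc (2 * π * a n * t)) (fun N => ?_)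
    (tendsto_pi_nhds.2 (tendsto_prod_sincProd ha ha0))
  have := continuous_sinc
  exact Continuous.measurable (by fun_prop)

/-- Multiplying `P` by `sincProd a` keeps the value of the Fourier transform at `x` if the transform
is constant within distance `∑ aₙ` of `x`. -/
theorem integral_mul_sincProd_mul_exp {P : ℝ → ℂ} (hP : Integrable P) {a : ℕ → ℝ}
    (ha : Summable a) (ha0 : ∀ n, 0 ≤ a n) {x : ℝ} {z : ℂ}
    (h : ∀ y, |y - x| ≤ ∑' n, a n →
      ∫ t, P t * Complex.exp (↑(2 * π * (t * y)) * Complex.I) = z) :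
    ∫ t, (P t * (sincProd a t : ℂ)) * Complex.exp (↑(2 * π * (t * x)) * Complex.I) = z := by
  have hN : ∀ N, ∫ t, (P t * ((∏ n ∈ Finset.range N, sinc (2 * π * a n * t) : ℝ) : ℂ)) *
      Complex.exp (↑(2 * π * (t * x)) * Complex.I) = z := fun N =>
    integral_mul_prod_sinc_mul_exp hP ha0 N fun y hy =>
      h y (hy.trans (ha.sum_le_tsum _ fun n _ => ha0 n))
  refine tendsto_nhds_unique (tendsto_integral_of_dominated_convergence (fun t => ‖P t‖)
    (F := fun N t => (P t * ((∏ n ∈ Finset.range N, sinc (2 * π * a n * t) : ℝ) : ℂ)) *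
      Complex.exp (↑(2 * π * (t * x)) * Complex.I)) (fun N => ?_) hP.norm (fun N => ?_) ?_)
    (by simp_rw [hN]; exact tendsto_const_nhds)
  · refine (integrable_mul_prod_sinc hP a N).aestronglyMeasurable.mul ?_
    apply Continuous.aestronglyMeasurable; fun_prop
  · refine Eventually.of_forall fun t => ?_
    rw [norm_mul, norm_mul, Complex.norm_exp_ofReal_mul_I, mul_one, Complex.norm_real, norm_eq_abs,
      Finset.abs_prod]
    exact mul_le_of_le_one_right (norm_nonneg _)
      (Finset.prod_le_one (fun _ _ => abs_nonneg _) fun _ _ => abs_sinc_le_one _)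
  · refine Eventually.of_forall fun t => ?_
    refine Tendsto.mul_const _ (Tendsto.const_mul _ ?_)
    exact (Complex.continuous_ofReal.tendsto _).comp (tendsto_prod_sincProd ha ha0 t)

/-- A lower power of `y` with any coefficient is dominated by a higher power up to a constant. -/
theorem exists_mul_rpow_le_add {γ δ : ℝ} (hγ : 0 < γ) (h : γ < δ) (c : ℝ) {d : ℝ} (hd : 0 < d) :
    ∃ K : ℝ, ∀ y : ℝ, 0 ≤ y → c * y ^ γ ≤ d * y ^ δ + K := by
  have h1 : ∀ᶠ y : ℝ in atTop, |c| * y ^ γ ≤ d * y ^ δ := by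
    have h2 := (tendsto_rpow_atTop (sub_pos.2 h)).eventually_ge_atTop (|c| / d)
    filter_upwards [h2, eventually_gt_atTop 0] with y hy hy0
    have : y ^ δ = y ^ (δ - γ) * y ^ γ := by rw [← rpow_add hy0]; ring_nf
    rw [this, ← mul_assoc]
    have := rpow_nonneg hy0.le γ
    rw [div_le_iff₀' hd] at hy
    gcongr
  obtain ⟨Y, hY⟩ := (h1.and (eventually_ge_atTop 0)).exists_forall_of_atTop
  refine ⟨|c| * Y ^ γ, fun y hy => ?_⟩
  have hY0 : 0 ≤ Y := (hY Y le_rfl).2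
  have h0 : c * y ^ γ ≤ |c| * y ^ γ := by
    have := rpow_nonneg hy γ
    gcongr; exact le_abs_self c
  rcases le_total Y y with hyY | hyY
  · have := (hY y hyY).1
    have : 0 ≤ |c| * Y ^ γ := by positivity
    linarith
  · have : |c| * y ^ γ ≤ |c| * Y ^ γ := by gcongr
    have : 0 ≤ d * y ^ δ := by positivity
    linarith

/-- There are summable sequences with arbitrarily small sum whose product of cardinal sines is
`O(exp (-c |t| ^ γ))`, for any given `γ < 1` and `c`. -/
theorem exists_sincProd_decay {γ : ℝ} (hγ : 0 < γ) (hγ1 : γ < 1) (c : ℝ) {r : ℝ} (hr : 0 < r) :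
    ∃ a : ℕ → ℝ, Summable a ∧ (∀ n, 0 ≤ a n) ∧ ∑' n, a n ≤ r ∧
      ∃ K : ℝ, ∀ t, exp (c * |t| ^ γ) * |sincProd a t| ≤ K := by
  -- `aₙ = ε (n + 1) ^ (-1 / δ)` is summable since `δ < 1`, and the `n` with `1 ≤ aₙ |t|` number
  -- about `(ε |t|) ^ δ`, which beats `|t| ^ γ` since `γ < δ`
  set δ := (1 + γ) / 2 with hδ
  have hδγ : γ < δ := by rw [hδ]; linarith
  have hδ1 : δ < 1 := by rw [hδ]; linarith
  have hδ0 : 0 < δ := hγ.trans hδγ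
  have hs : 1 < δ⁻¹ := (one_lt_inv₀ hδ0).2 hδ1
  have hsum : Summable fun n : ℕ => (((n : ℝ) + 1) ^ δ⁻¹)⁻¹ := by
    have := (summable_nat_add_iff 1).2 (Real.summable_nat_rpow_inv.2 hs)
    simpa using this
  set T := ∑' n : ℕ, (((n : ℝ) + 1) ^ δ⁻¹)⁻¹ with hT
  have hT0 : 0 ≤ T := tsum_nonneg fun n => by positivity
  set ε := r / (T + 1) with hε
  have hε0 : 0 < ε := by positivity
  have ha : Summable fun n : ℕ => ε * (((n : ℝ) + 1) ^ δ⁻¹)⁻¹ := hsum.mul_left ε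
  have ha0 : ∀ n : ℕ, 0 ≤ ε * (((n : ℝ) + 1) ^ δ⁻¹)⁻¹ := fun n => by positivity
  refine ⟨fun n => ε * (((n : ℝ) + 1) ^ δ⁻¹)⁻¹, ha, ha0, ?_, ?_⟩
  · rw [tsum_mul_left, ← hT, hε, div_mul_eq_mul_div, div_le_iff₀ (by positivity)]
    nlinarith
  obtain ⟨K, hK⟩ := exists_mul_rpow_le_add hγ hδγ c (d := log 2 * ε ^ δ) (by positivity)
  refine ⟨exp (K + log 2), fun t => ?_⟩
  set N := ⌊(ε * |t|) ^ δ⌋₊ with hN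
  have h1 : |sincProd (fun n : ℕ => ε * (((n : ℝ) + 1) ^ δ⁻¹)⁻¹) t| ≤ (1 / 2) ^ N := by
    refine abs_sincProd_le_pow ha ha0 fun n hn => ?_
    have h2 : ((n : ℝ) + 1) ≤ (ε * |t|) ^ δ := by
      have : ((n + 1 : ℕ) : ℝ) ≤ (ε * |t|) ^ δ :=
        (Nat.le_floor_iff (by positivity)).1 (Nat.succ_le_of_lt hn)
      exact_mod_cast this
    have h3 : ((n : ℝ) + 1) ^ δ⁻¹ ≤ ε * |t| := by
      rwa [Real.rpow_inv_le_iff_of_pos (by positivity) (by positivity) hδ0]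
    rw [mul_right_comm, ← div_eq_mul_inv, le_div_iff₀ (by positivity), one_mul]
    exact h3
  have h2 : ((1 : ℝ) / 2) ^ N ≤ exp (log 2 - log 2 * ((ε * |t|) ^ δ)) := by
    have : ((1 : ℝ) / 2) ^ N = exp (-(log 2 * N)) := by
      rw [exp_neg, mul_comm, exp_nat_mul, exp_log (by norm_num)]; simp
    rw [this, exp_le_exp]
    have := (Nat.lt_floor_add_one ((ε * |t|) ^ δ)).le
    rw [← hN] at this
    have h2 : 0 < log 2 := log_pos (by norm_num)
    nlinarith
  calc _ ≤ exp (c * |t| ^ γ) * exp (log 2 - log 2 * ((ε * |t|) ^ δ)) := by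
        gcongr; exact h1.trans h2
    _ ≤ _ := by
        rw [← exp_add, exp_le_exp, mul_rpow hε0.le (abs_nonneg t)]
        have := hK |t| (abs_nonneg t)
        linarith

/-- Fourier inversion for a smooth bump function. -/
theorem exists_integrable_fourier_bump {r : ℝ} (hr : 0 < r) : ∃ P : ℝ → ℂ, Integrable P ∧
    (∀ y, |y| ≤ r → ∫ t, P t * Complex.exp (↑(2 * π * (t * y)) * Complex.I) = 1) ∧
    (∀ y, 2 * r ≤ |y| → ∫ t, P t * Complex.exp (↑(2 * π * (t * y)) * Complex.I) = 0) := by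
  let b : ContDiffBump (0 : ℝ) := ⟨r, 2 * r, hr, by linarith⟩
  let f : ℝ → ℂ := fun x => (b x : ℂ)
  have hf1 : HasCompactSupport f := b.hasCompactSupport.comp_left (g := ((↑) : ℝ → ℂ)) rfl
  have hf2 : ContDiff ℝ (⊤ : ℕ∞) f := Complex.ofRealCLM.contDiff.comp b.contDiff
  let S : SchwartzMap ℝ ℂ := hf1.toSchwartzMap hf2
  have key : ∀ y : ℝ, ∫ t, (FourierTransform.fourier S) t *
      Complex.exp (↑(2 * π * (t * y)) * Complex.I) = f y := by
    intro y
    have h1 : FourierTransformInv.fourierInv (FourierTransform.fourier S) y = f y := by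
      rw [FourierTransform.fourierInv_fourier_eq]; rfl
    rw [← h1, SchwartzMap.fourierInv_coe, Real.fourierInv_eq']
    congr 1; ext t
    simp [mul_comm]
  refine ⟨FourierTransform.fourier S, SchwartzMap.integrable _, fun y hy => ?_, fun y hy => ?_⟩
  · rw [key]
    simp only [f]
    rw [b.one_of_mem_closedBall (by simpa [b] using hy)]
    simp
  · rw [key]
    simp only [f]
    rw [b.zero_of_le_dist (by simpa [b] using hy)]
    simp

/-- There are non-quasianalytic test functions for the weight `exp (c |t| ^ γ)`, `γ < 1`: a function
integrable against the weight whose Fourier transform is `1` at the origin and vanishes off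
`(-r, r)`. -/
theorem exists_weighted_integrable_fourier_bump {γ : ℝ} (hγ : 0 < γ) (hγ1 : γ < 1) (c : ℝ) {r : ℝ}
    (hr : 0 < r) : ∃ w : ℝ → ℂ, Integrable w ∧
    Integrable (fun t => exp (c * |t| ^ γ) * ‖w t‖) ∧
    ∫ t, w t = 1 ∧
    ∀ x, r ≤ |x| → ∫ t, w t * Complex.exp (↑(2 * π * (t * x)) * Complex.I) = 0 := by
  obtain ⟨a, ha, ha0, har, K, hK⟩ := exists_sincProd_decay hγ hγ1 c (r := r / 4) (by positivity)
  obtain ⟨P, hP, hP1, hP0⟩ := exists_integrable_fourier_bump (r := r / 4) (by positivity)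
  have hm : Measurable fun t => (sincProd a t : ℂ) :=
    Complex.measurable_ofReal.comp (measurable_sincProd ha ha0)
  have hw : Integrable (fun t => P t * (sincProd a t : ℂ)) := by
    refine hP.mul_bdd (c := 1) hm.aestronglyMeasurable (Eventually.of_forall fun t => ?_)
    rw [Complex.norm_real, norm_eq_abs]
    simpa using abs_sincProd_le_pow ha ha0 (t := t) (N := 0) (by simp)
  refine ⟨fun t => P t * (sincProd a t : ℂ), hw, ?_, ?_, fun x hx => ?_⟩
  · refine (hP.norm.const_mul K).mono' ?_ (Eventually.of_forall fun t => ?_)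
    · have : Measurable fun t : ℝ => exp (c * |t| ^ γ) := by fun_prop
      exact this.aestronglyMeasurable.mul hw.norm.aestronglyMeasurable
    · rw [norm_mul, norm_norm, norm_mul, Complex.norm_real, norm_eq_abs (exp _), abs_exp,
        norm_eq_abs (sincProd a t)]
      calc _ = exp (c * |t| ^ γ) * |sincProd a t| * ‖P t‖ := by ring
        _ ≤ _ := by gcongr; exact hK t
  · have := integral_mul_sincProd_mul_exp hP ha ha0 (x := 0) (z := 1) fun y hy => hP1 y ?_
    · simpa using this
    · simpa using hy.trans har
  · refine integral_mul_sincProd_mul_exp hP ha ha0 fun y hy => hP0 y ?_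
    have h1 := abs_sub_abs_le_abs_sub x y
    rw [abs_sub_comm] at h1
    linarith

end

/-! ### Sublinear growth -/

section

open Real

/-- A function with `L (k t) ≤ m L t + K` and `m < k` grows at most like `|t| ^ γ`, where
`γ = log m / log k < 1`. -/
theorem exists_rpow_bound_of_le_mul_add {L : ℝ → ℝ} {k m K M : ℝ} (hm : 1 < m) (hmk : m < k)
    (hK : 0 ≤ K) (hM : 0 ≤ M) (hL1 : ∀ t, |t| ≤ 1 → L t ≤ M)
    (hL : ∀ t, L (k * t) ≤ m * L t + K) :
    ∃ γ c : ℝ, 0 < γ ∧ γ < 1 ∧ 0 ≤ c ∧ ∀ t, L t ≤ c + c * |t| ^ γ := by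
  have hk : 1 < k := hm.trans hmk
  have hm0 : 0 < m := by linarith
  have hk0 : 0 < k := by linarith
  have hm1 : 0 < m - 1 := by linarith
  -- the shift by the fixed point turns the affine recursion into a linear one
  set M' := M + K / (m - 1) with hM'
  have hKm : 0 ≤ K / (m - 1) := by positivity
  have hM'0 : 0 ≤ M' := by positivity
  have key : ∀ n : ℕ, ∀ t, |t| ≤ k ^ n → L t + K / (m - 1) ≤ M' * m ^ n := by
    intro n
    induction n with
    | zero => intro t ht; have := hL1 t (by simpa using ht); rw [hM']; simpa using this
    | succ n ih =>
      intro t ht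
      have h1 : |t / k| ≤ k ^ n := by
        rw [abs_div, abs_of_pos hk0, div_le_iff₀ hk0, ← pow_succ]; exact ht
      have h2 := ih _ h1
      have h3 := hL (t / k)
      rw [mul_div_cancel₀ _ hk0.ne'] at h3
      have h4 : K + K / (m - 1) = m * (K / (m - 1)) := by field_simp; ring
      calc L t + K / (m - 1) ≤ m * (L (t / k) + K / (m - 1)) := by linarith
        _ ≤ m * (M' * m ^ n) := by gcongr
        _ = _ := by ring
  have hγ : 0 < log m / log k := div_pos (log_pos hm) (log_pos hk)
  refine ⟨log m / log k, M' * m, hγ,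
    (div_lt_one (log_pos hk)).2 (log_lt_log hm0 hmk), by positivity, fun t => ?_⟩
  have hkγ : k ^ (log m / log k) = m := by
    rw [rpow_def_of_pos hk0, mul_div_cancel₀ _ (log_pos hk).ne', exp_log hm0]
  have h0 : 0 ≤ |t| ^ (log m / log k) := by positivity
  rcases le_total |t| 1 with h | h
  · have := key 0 t (by simpa using h)
    have h5 : M' * 1 ≤ M' * m := by gcongr
    have : 0 ≤ M' * m * |t| ^ (log m / log k) := by positivity
    simp at *
    linarith
  · obtain ⟨n, hn, hn'⟩ := exists_nat_pow_near h hk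
    have h1 := key (n + 1) t hn'.le
    have h2 : m ^ n ≤ |t| ^ (log m / log k) := by
      calc m ^ n = (k ^ n) ^ (log m / log k) := by
            rw [← rpow_natCast k n, ← rpow_mul hk0.le, mul_comm, rpow_mul hk0.le, hkγ,
              rpow_natCast]
        _ ≤ _ := by gcongr
    have h3 : M' * m ^ (n + 1) ≤ M' * m * |t| ^ (log m / log k) := by
      rw [pow_succ', ← mul_assoc]; gcongr
    have : 0 ≤ M' * m := by positivity
    linarith

/-- Sublinear exponents do not dominate linear ones. -/
theorem eq_zero_of_forall_mul_le_rpow {y c γ : ℝ} (hγ0 : 0 < γ) (hγ : γ < 1)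
    (h : ∀ t : ℝ, t * y ≤ c + c * |t| ^ γ) : y = 0 := by
  by_contra hy
  have hy' : 0 < |y| := abs_pos.2 hy
  obtain ⟨K, hK⟩ := exists_mul_rpow_le_add hγ0 hγ c (d := |y| / 2) (by positivity)
  have h1 : ∀ T : ℝ, 0 ≤ T → T * |y| ≤ c + c * T ^ γ := by
    intro T hT
    rcases abs_choice y with e | e
    · simpa [e, abs_of_nonneg hT] using h T
    · simpa [e, abs_of_nonneg hT] using h (-T)
  have hT := h1 ((|c + K| + 1) * 2 / |y|) (by positivity)
  have hT2 := hK ((|c + K| + 1) * 2 / |y|) (by positivity)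
  rw [rpow_one] at hT2
  have e1 : (|c + K| + 1) * 2 / |y| * |y| = (|c + K| + 1) * 2 := by field_simp
  have e2 : |y| / 2 * ((|c + K| + 1) * 2 / |y|) = |c + K| + 1 := by field_simp
  rw [e1] at hT
  rw [e2] at hT2
  have := le_abs_self (c + K)
  linarith

end

/-! ### The `ℓ¹`-unitization and exponentials -/

section

open MeasureTheory Real Filter Topology WithLp WeakDual

section Unitization

variable {E : Type*} [NonUnitalNormedRing E] [NormedSpace ℂ E] [IsScalarTower ℂ E E]
  [SMulCommClass ℂ E E]

instance : NormOneClass (WithLp 1 (Unitization ℂ E)) where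
  norm_one := by
    rw [unitization_norm_def]
    change ‖(1 : Unitization ℂ E).fst‖ + ‖(1 : Unitization ℂ E).snd‖ = 1
    simp

variable (E) in
/-- The inclusion of an algebra into its `ℓ¹`-unitization. -/
noncomputable def l1UnitizationInr : E →ₙₐ[ℂ] WithLp 1 (Unitization ℂ E) :=
  ((unitizationAlgEquiv (𝕜 := ℂ) (A := E) ℂ).symm.toAlgHom : _ →ₙₐ[ℂ] _).comp
    (Unitization.inrNonUnitalAlgHom ℂ E)

theorem norm_l1UnitizationInr (x : E) : ‖l1UnitizationInr E x‖ = ‖x‖ := unitization_norm_inr x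

theorem l1UnitizationInr_posPow (x : E) (n : ℕ) :
    l1UnitizationInr E (DiffSubalg.posPow x (n + 1)) = l1UnitizationInr E x ^ (n + 1) := by
  induction n with
  | zero => simp [DiffSubalg.posPow]
  | succ n ih => rw [DiffSubalg.posPow, map_mul, ih, ← pow_succ]

/-- The unital extension of a homomorphism to the `ℓ¹`-unitization. -/
noncomputable def l1UnitizationLift {C : Type*} [Ring C] [Algebra ℂ C] (f : E →ₙₐ[ℂ] C) :
    WithLp 1 (Unitization ℂ E) →ₐ[ℂ] C :=
  (Unitization.lift f).comp (unitizationAlgEquiv (𝕜 := ℂ) (A := E) ℂ).toAlgHom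

theorem l1UnitizationLift_apply {C : Type*} [Ring C] [Algebra ℂ C] (f : E →ₙₐ[ℂ] C)
    (z : WithLp 1 (Unitization ℂ E)) :
    l1UnitizationLift f z = algebraMap ℂ C (ofLp z).fst + f (ofLp z).snd := rfl

@[simp]
theorem l1UnitizationLift_inr {C : Type*} [Ring C] [Algebra ℂ C] (f : E →ₙₐ[ℂ] C) (x : E) :
    l1UnitizationLift f (toLp 1 (x : Unitization ℂ E)) = f x := by
  simp [l1UnitizationLift_apply]

theorem continuous_l1UnitizationLift {C : Type*} [NormedRing C] [NormedAlgebra ℂ C]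
    {f : E →ₙₐ[ℂ] C} (hf : ∀ x, ‖f x‖ ≤ ‖x‖) : Continuous (l1UnitizationLift f) := by
  refine AddMonoidHomClass.continuous_of_bound (l1UnitizationLift f) (‖(1 : C)‖ + 1) fun z => ?_
  rw [l1UnitizationLift_apply, unitization_norm_def]
  refine (norm_add_le _ _).trans ?_
  rw [norm_algebraMap]
  have := hf (ofLp z).snd
  nlinarith [norm_nonneg (1 : C), norm_nonneg (ofLp z).fst, norm_nonneg (ofLp z).snd]

variable [CompleteSpace E]

/-- Automatic continuity: a multiplicative functional lifts to a unital one on the unitization,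
whose values lie in the spectrum. -/
theorem norm_apply_le_of_nonUnitalAlgHom (φ : E →ₙₐ[ℂ] ℂ) (x : E) : ‖φ x‖ ≤ ‖x‖ := by
  have := AlgHom.norm_apply_le_self (l1UnitizationLift φ) (toLp 1 (x : Unitization ℂ E))
  rwa [l1UnitizationLift_inr, unitization_norm_inr] at this

theorem exists_character_eq (φ : E →ₙₐ[ℂ] ℂ) {x : E} (hx : φ x ≠ 0) :
    ∃ ψ : characterSpace ℂ E, ∀ y, ψ y = φ y := by
  let χ : E →L[ℂ] ℂ := LinearMap.mkContinuous (φ : E →ₗ[ℂ] ℂ) 1 fun y => by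
    rw [one_mul]; exact norm_apply_le_of_nonUnitalAlgHom φ y
  refine ⟨⟨StrongDual.toWeakDual χ, fun hz => hx ?_, fun y z => map_mul φ y z⟩, fun y => rfl⟩
  exact congrArg (fun f : WeakDual ℂ E => f x) hz

/-- A homomorphism into a C*-algebra does not increase the norm of elements with normal image,
because it does not increase the spectral radius. -/
theorem norm_apply_le_of_isStarNormal {B : Type*} [NonUnitalCStarAlgebra B] (j : E →ₙₐ[ℂ] B)
    {x : E} (hx : IsStarNormal (j x)) : ‖j x‖ ≤ ‖x‖ := by
  let J := l1UnitizationLift ((Unitization.inrNonUnitalAlgHom ℂ B).comp j)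
  have hJ : J (toLp 1 (x : Unitization ℂ E)) = (j x : Unitization ℂ B) := by simp [J]
  have h1 : IsStarNormal (j x : Unitization ℂ B) := Unitization.isStarNormal_inr.2 hx
  have h2 : spectralRadius ℂ (J (toLp 1 (x : Unitization ℂ E))) ≤
      spectralRadius ℂ (toLp 1 (x : Unitization ℂ E)) :=
    iSup_le_iSup_of_subset (AlgHom.spectrum_apply_subset J _)
  rw [hJ, h1.spectralRadius_eq_nnnorm] at h2
  have h3 := h2.trans (spectrum.spectralRadius_le_nnnorm _)
  rw [unitization_nnnorm_inr, Unitization.nnnorm_inr] at h3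
  exact_mod_cast h3

/-- If all characters of a commutative Banach algebra vanish at `x`, then so does the image of `x`
under a homomorphism into a C*-algebra, provided it is normal. -/
theorem apply_eq_zero_of_forall_character {B : Type*} [NonUnitalCStarAlgebra B] (j : E →ₙₐ[ℂ] B)
    (hcomm : ∀ x y : E, x * y = y * x) {x : E} (hx : IsStarNormal (j x))
    (h : ∀ φ : characterSpace ℂ E, φ x = 0) : j x = 0 := by
  let J := l1UnitizationLift ((Unitization.inrNonUnitalAlgHom ℂ B).comp j)
  have hJ : J (toLp 1 (x : Unitization ℂ E)) = (j x : Unitization ℂ B) := by simp [J]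
  have h1 : IsStarNormal (j x : Unitization ℂ B) := Unitization.isStarNormal_inr.2 hx
  let _ : NormedCommRing (WithLp 1 (Unitization ℂ E)) :=
    { (inferInstance : NormedRing (WithLp 1 (Unitization ℂ E))) with
      mul_comm := fun y z => by
        apply WithLp.ofLp_injective
        apply Unitization.ext
        · simp [mul_comm]
        · simp [hcomm, add_comm] }
  have h2 : ∀ z ∈ spectrum ℂ (toLp 1 (x : Unitization ℂ E)), z = 0 := by
    intro z hz
    obtain ⟨ψ, rfl⟩ := CharacterSpace.mem_spectrum_iff_exists.1 hz
    by_contra h0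
    obtain ⟨χ, hχ⟩ := exists_character_eq
      ((CharacterSpace.toNonUnitalAlgHom ψ).comp (l1UnitizationInr E)) (x := x) h0
    exact h0 ((hχ x).symm.trans (h χ))
  have h3 : spectralRadius ℂ (j x : Unitization ℂ B) = 0 := by
    rw [← hJ]
    refine le_antisymm (iSup₂_le fun z hz => ?_) zero_le
    rw [h2 z (AlgHom.spectrum_apply_subset J _ hz)]
    simp
  rw [h1.spectralRadius_eq_nnnorm, Unitization.nnnorm_inr] at h3
  simpa using h3

/-- `exp (2π i t a)` in the `ℓ¹`-unitization of a Banach algebra. -/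
noncomputable def unitizationExp (a : E) (t : ℝ) : WithLp 1 (Unitization ℂ E) :=
  NormedSpace.exp (((2 * π * t : ℝ) * Complex.I : ℂ) • toLp 1 (a : Unitization ℂ E))

/-- `exp (2π i t a) - 1`, an element of the algebra itself. -/
noncomputable def expSubOne (a : E) (t : ℝ) : E := (ofLp (unitizationExp a t)).snd

theorem map_unitizationExp {C : Type*} [NormedRing C] [NormedAlgebra ℂ C]
    {f : E →ₙₐ[ℂ] C} (hf : ∀ x, ‖f x‖ ≤ ‖x‖) (a : E) (t : ℝ) :
    l1UnitizationLift f (unitizationExp a t) =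
      NormedSpace.exp (((2 * π * t : ℝ) * Complex.I : ℂ) • f a) := by
  let _ : NormedAlgebra ℚ (WithLp 1 (Unitization ℂ E)) := .restrictScalars ℚ ℂ _
  let _ : NormedAlgebra ℚ C := .restrictScalars ℚ ℂ _
  rw [unitizationExp, NormedSpace.map_exp _ (continuous_l1UnitizationLift hf), map_smul,
    l1UnitizationLift_inr]

theorem unitizationExp_eq (a : E) (t : ℝ) :
    unitizationExp a t = 1 + toLp 1 (Unitization.inr (expSubOne a t) : Unitization ℂ E) := by
  apply WithLp.ofLp_injective
  apply Unitization.ext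
  -- the scalar part of the exponential is read off by the lift of the zero homomorphism
  · have h := map_unitizationExp (f := (0 : E →ₙₐ[ℂ] ℂ)) (by simp) a t
    rw [l1UnitizationLift_apply] at h
    simp at h
    change _ = (1 + (Unitization.inr (expSubOne a t) : Unitization ℂ E)).fst
    simpa using h
  · change _ = (1 + (Unitization.inr (expSubOne a t) : Unitization ℂ E)).snd
    simp [expSubOne]

theorem norm_unitizationExp (a : E) (t : ℝ) : ‖unitizationExp a t‖ = 1 + ‖expSubOne a t‖ := by
  rw [unitizationExp_eq, unitization_norm_def]
  change ‖(1 + (Unitization.inr (expSubOne a t) : Unitization ℂ E)).fst‖ +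
    ‖(1 + (Unitization.inr (expSubOne a t) : Unitization ℂ E)).snd‖ = _
  simp

theorem continuous_unitizationExp (a : E) : Continuous (unitizationExp a) := by
  let _ : NormedAlgebra ℚ (WithLp 1 (Unitization ℂ E)) := .restrictScalars ℚ ℂ _
  unfold unitizationExp
  exact NormedSpace.exp_continuous.comp (by fun_prop)

theorem continuous_expSubOne (a : E) : Continuous (expSubOne a) := by
  let s : WithLp 1 (Unitization ℂ E) →ₗ[ℂ] E :=
    (Unitization.sndHom ℂ ℂ E).comp (WithLp.linearEquiv 1 ℂ (Unitization ℂ E)).toLinearMap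
  have hs : Continuous s := by
    refine AddMonoidHomClass.continuous_of_bound s 1 fun z => ?_
    rw [unitization_norm_def, one_mul]
    exact le_add_of_nonneg_left (norm_nonneg _)
  exact hs.comp (continuous_unitizationExp a)

theorem unitizationExp_natCast_mul (a : E) (k : ℕ) (t : ℝ) :
    unitizationExp a (k * t) = unitizationExp a t ^ k := by
  let _ : NormedAlgebra ℚ (WithLp 1 (Unitization ℂ E)) := .restrictScalars ℚ ℂ _
  rw [unitizationExp, unitizationExp, ← NormedSpace.exp_nsmul]
  congr 1
  rw [← Nat.cast_smul_eq_nsmul ℂ, smul_smul]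
  congr 1
  push_cast
  ring

theorem map_expSubOne (φ : E →ₙₐ[ℂ] ℂ) (a : E) (t : ℝ) :
    φ (expSubOne a t) = Complex.exp ((2 * π * t : ℝ) * Complex.I * φ a) - 1 := by
  have h := map_unitizationExp (norm_apply_le_of_nonUnitalAlgHom φ) a t
  rw [unitizationExp_eq, map_add, map_one, l1UnitizationLift_inr, smul_eq_mul,
    ← Complex.exp_eq_exp_ℂ] at h
  rw [← h]; ring

/-- The image of `exp (2π i t a)` in the unitization of the C*-algebra is unitary. -/
theorem norm_map_expSubOne_le {B : Type*} [NonUnitalCStarAlgebra B] {j : E →ₙₐ[ℂ] B}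
    (hj : ∀ x, ‖j x‖ ≤ ‖x‖) {a : E} (ha : IsSelfAdjoint (j a)) (t : ℝ) :
    ‖j (expSubOne a t)‖ ≤ 2 := by
  have hJ : ∀ x, ‖((Unitization.inrNonUnitalAlgHom ℂ B).comp j) x‖ ≤ ‖x‖ := fun x => by
    change ‖(j x : Unitization ℂ B)‖ ≤ _
    rw [Unitization.norm_inr]; exact hj x
  have h := map_unitizationExp hJ a t
  rw [unitizationExp_eq, map_add, map_one, l1UnitizationLift_inr] at h
  change 1 + (Unitization.inr (j (expSubOne a t)) : Unitization ℂ B) =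
    NormedSpace.exp (_ • (j a : Unitization ℂ B)) at h
  let s : selfAdjoint (Unitization ℂ B) :=
    ⟨((2 * π * t : ℝ) : ℂ) • (j a : Unitization ℂ B), by
      refine IsSelfAdjoint.smul ?_ (ha.inr ℂ)
      exact Complex.conj_ofReal _⟩
  have h2 : NormedSpace.exp ((((2 * π * t : ℝ) : ℂ) * Complex.I) • (j a : Unitization ℂ B)) =
      selfAdjoint.expUnitary s := by
    rw [selfAdjoint.expUnitary_coe, mul_comm, ← smul_smul]
  rw [← Unitization.norm_inr (𝕜 := ℂ),
    ← add_sub_cancel_left 1 (Unitization.inr (j (expSubOne a t)) : Unitization ℂ B),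
    h, h2]
  refine (norm_sub_le _ _).trans ?_
  rw [norm_one, CStarRing.norm_coe_unitary]
  norm_num

end Unitization

end

/-! ### Representations of C*-algebras -/

section

open scoped ComplexOrder ComplexStarModule

section
variable {B : Type*} [NonUnitalCStarAlgebra B] [PartialOrder B] [StarOrderedRing B]

/-- The functional comes from Hahn–Banach separation of `-c` from the cone of positive elements. -/
theorem exists_positiveLinearMap_apply_ne_zero {c : B} (hc : 0 ≤ c) (hc0 : c ≠ 0) :
    ∃ f : B →ₚ[ℂ] ℂ, f c ≠ 0 := by
  have hneg : -c ∉ {x : B | 0 ≤ x} := fun h =>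
    hc0 (le_antisymm (neg_nonneg.1 h) hc)
  have hconv : Convex ℝ {x : B | 0 ≤ x} := by
    intro x hx y hy s t hs ht _
    exact add_nonneg (smul_nonneg hs hx) (smul_nonneg ht hy)
  obtain ⟨l, s, hls, hl⟩ :=
    geometric_hahn_banach_point_closed hconv CStarAlgebra.isClosed_nonneg hneg
  have hs : s < 0 := by simpa using hl 0 (le_refl (0 : B))
  -- a functional bounded below on a cone is nonnegative there
  have hpos : ∀ x : B, 0 ≤ x → 0 ≤ l x := by
    intro x hx
    by_contra! h
    have h1 := hl ((s / l x) • x) (smul_nonneg (div_nonneg_of_nonpos hs.le h.le) hx)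
    rw [map_smul, smul_eq_mul, div_mul_cancel₀ _ h.ne] at h1
    exact lt_irrefl _ h1
  -- `x ↦ l (ℜ x) + i l (ℑ x)` is complex linear and agrees with `l` on self-adjoint elements
  let g : B →ₗ[ℝ] ℝ := l.toLinearMap ∘ₗ (selfAdjoint.submodule ℝ B).subtype ∘ₗ realPart
  have hg : ∀ x : B, IsSelfAdjoint x → (Module.Dual.extendRCLike (𝕜 := ℂ) g) x = (l x : ℂ) := by
    intro x hx
    have h1 : g x = l x := congrArg l hx.coe_realPart
    have h2 : g (Complex.I • x) = 0 := by
      have : ((realPart (Complex.I • x) : selfAdjoint B) : B) = 0 := by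
        rw [realPart_I_smul, hx.imaginaryPart]; simp
      exact (congrArg l this).trans (map_zero l)
    rw [Module.Dual.extendRCLike_apply]
    simp [h1, h2]
  refine ⟨PositiveLinearMap.mk₀ (Module.Dual.extendRCLike (𝕜 := ℂ) g) fun x hx => ?_, ?_⟩
  · rw [hg x (IsSelfAdjoint.of_nonneg hx)]
    exact_mod_cast hpos x hx
  · change Module.Dual.extendRCLike (𝕜 := ℂ) g c ≠ 0
    rw [hg c (IsSelfAdjoint.of_nonneg hc)]
    have : 0 < l c := by rw [map_neg] at hls; linarith
    exact_mod_cast this.ne'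

end

/-- The representations of a C*-algebra on Hilbert spaces separate its points. -/
theorem NonUnitalCStarAlgebra.exists_representation_ne_zero {B : Type u} [NonUnitalCStarAlgebra B]
    {b : B} (hb : b ≠ 0) :
    ∃ (H : Type u) (_ : NormedAddCommGroup H) (_ : InnerProductSpace ℂ H)
      (_ : CompleteSpace H) (π : B →⋆ₙₐ[ℂ] (H →L[ℂ] H)), π b ≠ 0 := by
  let _ := CStarAlgebra.spectralOrder B
  have := CStarAlgebra.spectralOrderedRing B
  -- without a unit, `b` is tested on the vector given by `star b`
  have h1 : b * star b ≠ 0 := CStarRing.mul_star_self_ne_zero_iff _ |>.2 hb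
  have h2 : star (b * star b) * (b * star b) ≠ 0 := CStarRing.star_mul_self_ne_zero_iff _ |>.2 h1
  obtain ⟨f, hf⟩ := exists_positiveLinearMap_apply_ne_zero (star_mul_self_nonneg (b * star b)) h2
  refine ⟨f.GNS, inferInstance, inferInstance, inferInstance, f.gnsNonUnitalStarAlgHom, fun h => ?_⟩
  have h3 := f.gnsNonUnitalStarAlgHom_apply_coe (a := b) (b := f.toPreGNS (star b))
  rw [h] at h3
  have h4 : f.leftMulMapPreGNS b (f.toPreGNS (star b)) = f.toPreGNS (b * star b) := by simp
  have h5 : ‖f.toPreGNS (b * star b)‖ = 0 := by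
    rw [← h4, ← UniformSpace.Completion.norm_coe, ← h3]; simp
  apply hf
  have h6 := f.preGNS_norm_sq (f.toPreGNS (b * star b))
  rw [h5] at h6
  simpa using h6.symm

end

/-! ### Regularity from a differential inequality -/

section

open MeasureTheory Real Filter Topology WithLp WeakDual

section Differential

variable {E : Type*} [NonUnitalNormedRing E] [NormedSpace ℂ E] [IsScalarTower ℂ E E]
  [SMulCommClass ℂ E E] [CompleteSpace E]

theorem unitizationExp_eq_one_add (a : E) (t : ℝ) :
    unitizationExp a t = 1 + l1UnitizationInr E (expSubOne a t) := unitizationExp_eq a t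

/-- Expanding `(u - 1) ^ k` with `u = exp (2π i t a)` isolates `u ^ k = exp (2π i k t a)`; the
remaining powers of `u` have exponent at most `k - 1`, and `(u - 1) ^ k` is controlled by the
differential inequality. -/
theorem norm_unitizationExp_natCast_mul_le (a : E) {k : ℕ} (hk : 2 ≤ k) {p C m : ℝ}
    (hpm : p ≤ m) (hkm : (k : ℝ) - 1 ≤ m) (hp : 0 ≤ p) (hC : 0 ≤ C)
    (h : ∀ t, ‖DiffSubalg.posPow (expSubOne a t) k‖ ≤ C * ‖expSubOne a t‖ ^ p) (t : ℝ) :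
    ‖unitizationExp a (k * t)‖ ≤ (C + 2 ^ k) * ‖unitizationExp a t‖ ^ m := by
  set u := unitizationExp a t with hu
  set v := expSubOne a t with hv
  have hn : ‖u‖ = 1 + ‖v‖ := norm_unitizationExp a t
  have hu1 : 1 ≤ ‖u‖ := by rw [hn]; linarith [norm_nonneg v]
  have huv : u - 1 = l1UnitizationInr E v := by
    rw [hu, unitizationExp_eq_one_add]; simp [hv]
  obtain ⟨l, rfl⟩ : ∃ l, k = l + 1 := ⟨k - 1, by omega⟩
  have h1 : ‖(u - 1) ^ (l + 1)‖ ≤ C * ‖u‖ ^ m := by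
    rw [huv, ← l1UnitizationInr_posPow, norm_l1UnitizationInr]
    refine (h t).trans ?_
    gcongr
    calc ‖v‖ ^ p ≤ ‖u‖ ^ p := by
          apply rpow_le_rpow (norm_nonneg _) _ hp; rw [hn]; linarith
      _ ≤ _ := rpow_le_rpow_of_exponent_le hu1 hpm
  have h2 : u ^ (l + 1) = (u - 1) ^ (l + 1) -
      ∑ i ∈ Finset.range (l + 1), u ^ i * (-1) ^ (l + 1 - i) * ((l + 1).choose i : ℕ) := by
    have hc : Commute u (-1) := (Commute.one_right u).neg_right
    rw [sub_eq_add_neg u 1, hc.add_pow, Finset.sum_range_succ _ (l + 1)]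
    simp
  have h3 : ∀ i ∈ Finset.range (l + 1), ‖u ^ i * (-1) ^ (l + 1 - i) * ((l + 1).choose i : ℕ)‖ ≤
      ‖u‖ ^ m * ((l + 1).choose i : ℝ) := by
    intro i hi
    have e : u ^ i * (-1) ^ (l + 1 - i) * (((l + 1).choose i : ℕ) : WithLp 1 (Unitization ℂ E)) =
        ((-1 : ℂ) ^ (l + 1 - i) * ((l + 1).choose i : ℂ)) • u ^ i := by
      rw [Algebra.smul_def, Algebra.commutes, map_mul, map_pow, map_neg, map_one, map_natCast,
        mul_assoc]
    rw [e, norm_smul, norm_mul, norm_pow, norm_neg, norm_one, one_pow, one_mul,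
      Complex.norm_natCast, mul_comm]
    gcongr
    refine (norm_pow_le _ _).trans ?_
    rw [← rpow_natCast]
    apply rpow_le_rpow_of_exponent_le hu1
    have : (i : ℝ) ≤ l := by exact_mod_cast Nat.lt_succ_iff.1 (Finset.mem_range.1 hi)
    push_cast at hkm
    linarith
  rw [unitizationExp_natCast_mul, ← hu, h2]
  have h4 : ∑ i ∈ Finset.range (l + 1), ((l + 1).choose i : ℝ) ≤ 2 ^ (l + 1) := by
    have := Nat.sum_range_choose (l + 1)
    rw [Finset.sum_range_succ] at this
    have h5 : ∑ i ∈ Finset.range (l + 1), ((l + 1).choose i) ≤ 2 ^ (l + 1) := by omega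
    exact_mod_cast h5
  calc _ ≤ ‖(u - 1) ^ (l + 1)‖ + ‖∑ i ∈ Finset.range (l + 1),
        u ^ i * (-1) ^ (l + 1 - i) * (((l + 1).choose i : ℕ) : WithLp 1 (Unitization ℂ E))‖ :=
        norm_sub_le _ _
    _ ≤ C * ‖u‖ ^ m + ∑ i ∈ Finset.range (l + 1), ‖u‖ ^ m * ((l + 1).choose i : ℝ) := by
        gcongr
        exact norm_sum_le_of_le _ h3
    _ = C * ‖u‖ ^ m + ‖u‖ ^ m * ∑ i ∈ Finset.range (l + 1), ((l + 1).choose i : ℝ) := by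
        rw [Finset.mul_sum]
    _ ≤ C * ‖u‖ ^ m + ‖u‖ ^ m * 2 ^ (l + 1) := by gcongr
    _ = _ := by ring

/-- Under a differential inequality of order `k` with exponent `p < k`, the group
`exp (2π i t a)` grows at most like `exp (c |t| ^ γ)` with `γ < 1`. -/
theorem exists_norm_unitizationExp_le (a : E) {k : ℕ} (hk : 2 ≤ k) {p C : ℝ}
    (hp : 0 ≤ p) (hpk : p < k) (hC : 0 ≤ C)
    (h : ∀ t, ‖DiffSubalg.posPow (expSubOne a t) k‖ ≤ C * ‖expSubOne a t‖ ^ p) :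
    ∃ γ c : ℝ, 0 < γ ∧ γ < 1 ∧ 0 ≤ c ∧
      ∀ t, ‖unitizationExp a t‖ ≤ exp (c + c * |t| ^ γ) := by
  have hk2 : (2 : ℝ) ≤ k := by exact_mod_cast hk
  -- the last entry only ensures `1 < m`
  set m : ℝ := max (max p (k - 1)) ((1 + k) / 2) with hm
  have hm1 : 1 < m := lt_of_lt_of_le (by linarith) (le_max_right _ _)
  have hmk : m < k := max_lt (max_lt hpk (by linarith)) (by linarith)
  have hu1 : ∀ t, 1 ≤ ‖unitizationExp a t‖ := fun t => by
    rw [norm_unitizationExp]; linarith [norm_nonneg (expSubOne a t)]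
  have hK : (1 : ℝ) ≤ C + 2 ^ k := by
    have : (1 : ℝ) ≤ 2 ^ k := one_le_pow₀ (by norm_num)
    linarith
  obtain ⟨t₀, -, ht₀⟩ := (isCompact_Icc (a := (-1 : ℝ)) (b := 1)).exists_isMaxOn
    ⟨0, by norm_num⟩ (continuous_unitizationExp a).norm.continuousOn
  obtain ⟨γ, c, hγ0, hγ1, hc, hL⟩ := exists_rpow_bound_of_le_mul_add
    (L := fun t => log ‖unitizationExp a t‖) (K := log (C + 2 ^ k)) hm1 hmk (log_nonneg hK)
    (log_nonneg (hu1 t₀)) (fun t ht => log_le_log (by linarith [hu1 t]) (ht₀ (abs_le.1 ht)))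
    (fun t => by
      have h1 := norm_unitizationExp_natCast_mul_le a hk (m := m)
        ((le_max_left _ _).trans (le_max_left _ _)) ((le_max_right _ _).trans (le_max_left _ _))
        hp hC h t
      have h0 : 0 < ‖unitizationExp a t‖ := by linarith [hu1 t]
      have h2 := log_le_log (by linarith [hu1 (k * t)]) h1
      rw [log_mul (by linarith) (by positivity), log_rpow h0] at h2
      linarith)
  refine ⟨γ, c, hγ0, hγ1, hc, fun t => ?_⟩
  rw [← log_le_iff_le_exp (by linarith [hu1 t])]
  exact hL t

/-- The Gelfand topology on the spectrum of a singly generated algebra is induced by evaluation at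
the generator. -/
theorem exists_dist_le_of_isClosed_characters {a : E}
    (hdense : ∀ S : NonUnitalSubalgebra ℂ E, IsClosed (S : Set E) → a ∈ S → S = ⊤)
    {X : Set (characterSpace ℂ E)} (hX : IsClosed X) {ω : characterSpace ℂ E} (hω : ω ∉ X) :
    ∃ r > 0, ∀ φ ∈ X, r ≤ ‖φ a - ω a‖ := by
  set F : Filter (characterSpace ℂ E) := comap (fun φ => φ a) (𝓝 (ω a)) with hF
  have hnorm : ∀ (φ : characterSpace ℂ E) (x : E), ‖φ x‖ ≤ ‖x‖ := fun φ x =>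
    norm_apply_le_of_nonUnitalAlgHom (CharacterSpace.toNonUnitalAlgHom φ) x
  -- the elements whose Gelfand transform converges to its value at `ω` along `F`
  let S : NonUnitalSubalgebra ℂ E :=
    { carrier := {x | Tendsto (fun φ : characterSpace ℂ E => φ x) F (𝓝 (ω x))}
      mul_mem' := fun {x y} hx hy => by
        simpa only [Set.mem_ofPred_eq, map_mul] using Tendsto.mul hx hy
      add_mem' := fun {x y} hx hy => by
        simpa only [Set.mem_ofPred_eq, map_add] using Tendsto.add hx hy
      zero_mem' := by simpa using tendsto_const_nhds
      smul_mem' := fun c x hx => by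
        simpa only [Set.mem_ofPred_eq, map_smul] using Tendsto.const_smul hx c }
  have hS : IsClosed (S : Set E) := by
    refine isClosed_of_closure_subset fun x hx => ?_
    change Tendsto (fun φ : characterSpace ℂ E => φ x) F (𝓝 (ω x))
    rw [Metric.tendsto_nhds]
    intro ε hε
    obtain ⟨y, hy, hxy⟩ := Metric.mem_closure_iff.1 hx (ε / 3) (by positivity)
    filter_upwards [Metric.tendsto_nhds.1 (show Tendsto _ F (𝓝 (ω y)) from hy) (ε / 3)
      (by positivity)] with φ hφ
    have h1 : dist (φ x) (φ y) ≤ dist x y := by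
      rw [dist_eq_norm, ← map_sub, dist_eq_norm]; exact hnorm φ _
    have h2 : dist (ω y) (ω x) ≤ dist x y := by
      rw [dist_comm, dist_eq_norm, ← map_sub, dist_eq_norm]; exact hnorm ω _
    calc dist (φ x) (ω x) ≤ dist (φ x) (φ y) + dist (φ y) (ω y) + dist (ω y) (ω x) :=
          dist_triangle4 _ _ _ _
      _ < ε := by linarith
  have hST : S = ⊤ := hdense S hS tendsto_comap
  have hid : Tendsto id F (𝓝 ω) := by
    rw [tendsto_subtype_rng]
    refine tendsto_iff_forall_eval_tendsto_topDualPairing.2 fun x => ?_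
    have : x ∈ S := hST ▸ trivial
    exact this
  have hmem : Xᶜ ∈ F := hid (hX.isOpen_compl.mem_nhds hω)
  obtain ⟨V, hV, hVX⟩ := hmem
  obtain ⟨r, hr, hrV⟩ := Metric.mem_nhds_iff.1 hV
  refine ⟨r, hr, fun φ hφ => ?_⟩
  by_contra! h
  exact hVX (hrV (by rwa [Metric.mem_ball, dist_eq_norm]) : φ a ∈ V) hφ

/-- Characters are real at `a`: otherwise `|φ (exp (2π i t a))| ≤ ‖exp (2π i t a)‖` would grow
exponentially as `t → ∞` or `t → -∞`. -/
theorem im_character_eq_zero {a : E} {γ c : ℝ} (hγ0 : 0 < γ) (hγ1 : γ < 1)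
    (hu : ∀ t, ‖unitizationExp a t‖ ≤ exp (c + c * |t| ^ γ)) (φ : characterSpace ℂ E) :
    (φ a).im = 0 := by
  have h1 : -(2 * π * (φ a).im) = 0 := by
    refine eq_zero_of_forall_mul_le_rpow (c := c) hγ0 hγ1 fun t => ?_
    have h2 := AlgHom.norm_apply_le_self (l1UnitizationLift (CharacterSpace.toNonUnitalAlgHom φ))
      (unitizationExp a t)
    rw [map_unitizationExp (norm_apply_le_of_nonUnitalAlgHom _), smul_eq_mul,
      ← Complex.exp_eq_exp_ℂ, Complex.norm_exp] at h2
    have h3 := exp_le_exp.1 (h2.trans (hu t))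
    refine le_trans (le_of_eq ?_) h3
    simp
    ring
  have := pi_pos
  simpa [this.ne'] using h1

/-- Local elements: an element of a singly generated Banach algebra whose Gelfand transform is a
bump function around a prescribed point of the spectrum. -/
theorem exists_bump_of_norm_unitizationExp_le {a : E} {γ c : ℝ} (hγ0 : 0 < γ) (hγ1 : γ < 1)
    (hu : ∀ t, ‖unitizationExp a t‖ ≤ exp (c + c * |t| ^ γ)) (ω : characterSpace ℂ E)
    (hω : ω a ≠ 0) {r : ℝ} (hr : 0 < r) :
    ∃ x : E, ω x = 1 ∧ ∀ φ : characterSpace ℂ E, r ≤ ‖φ a - ω a‖ → φ x = 0 := by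
  have hreal : ∀ φ : characterSpace ℂ E, φ a = ((φ a).re : ℂ) := fun φ =>
    Complex.ext rfl (by simpa using im_character_eq_zero hγ0 hγ1 hu φ)
  set y := (ω a).re with hy
  have hy0 : 0 < |y| := by
    refine abs_pos.2 fun h => hω ?_
    rw [hreal ω, ← hy, h, Complex.ofReal_zero]
  obtain ⟨w, hwI, hwi, hw1, hw0⟩ :=
    exists_weighted_integrable_fourier_bump hγ0 hγ1 c (lt_min hr hy0)
  -- the phase moves the support of the Fourier transform to a neighbourhood of `ω a`, away from `0`
  set g : ℝ → ℂ := fun t => w t * Complex.exp (↑(2 * π * (t * (-y))) * Complex.I) with hg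
  have hgm : AEStronglyMeasurable g := hwI.aestronglyMeasurable.mul (by
    apply Continuous.aestronglyMeasurable; fun_prop)
  have hgn : ∀ t, ‖g t‖ = ‖w t‖ := fun t => by
    simp only [hg, norm_mul, Complex.norm_exp_ofReal_mul_I, mul_one]
  have hint : Integrable fun t => g t • expSubOne a t := by
    refine (hwi.const_mul (exp c)).mono'
      (hgm.smul (continuous_expSubOne a).aestronglyMeasurable) (Eventually.of_forall fun t => ?_)
    rw [norm_smul, hgn, ← mul_assoc, ← exp_add, mul_comm]
    gcongr
    have := hu t
    rw [norm_unitizationExp] at this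
    linarith
  have hval : ∀ φ : characterSpace ℂ E, φ (∫ t, g t • expSubOne a t) =
      ∫ t, w t * Complex.exp (↑(2 * π * (t * ((φ a).re - y))) * Complex.I) := by
    intro φ
    have h1 : φ (∫ t, g t • expSubOne a t) = ∫ t, φ (g t • expSubOne a t) :=
      ((CharacterSpace.toCLM φ).integral_comp_comm hint).symm
    have hwe : ∀ s : ℝ, Integrable fun t =>
        w t * Complex.exp (↑(2 * π * (t * s)) * Complex.I) := fun s =>
      hwI.mul_bdd (c := 1) (by apply Continuous.aestronglyMeasurable; fun_prop)
        (Eventually.of_forall fun t => (Complex.norm_exp_ofReal_mul_I _).le)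
    -- subtracting `1` from the exponential is harmless: the translated bump vanishes at `0`
    have h0 : ∫ t, w t * Complex.exp (↑(2 * π * (t * (-y))) * Complex.I) = 0 :=
      hw0 _ (by rw [abs_neg]; exact min_le_right _ _)
    rw [h1, ← sub_zero (∫ t, w t * Complex.exp (↑(2 * π * (t * ((φ a).re - y))) * Complex.I)),
      ← h0, ← integral_sub (hwe _) (hwe _)]
    congr 1
    ext t
    have h2 := map_expSubOne (CharacterSpace.toNonUnitalAlgHom φ) a t
    rw [CharacterSpace.coe_toNonUnitalAlgHom] at h2
    rw [map_smul, h2, smul_eq_mul, hg, hreal φ, mul_sub, mul_one, mul_assoc (w t),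
      ← Complex.exp_add]
    congr 4
    push_cast
    simp
    ring
  refine ⟨∫ t, g t • expSubOne a t, ?_, fun φ hφ => ?_⟩
  · rw [hval, ← hy]
    simpa using hw1
  · rw [hval]
    refine hw0 _ ((min_le_left _ _).trans ?_)
    rw [hreal φ, hreal ω, ← Complex.ofReal_sub, Complex.norm_real, norm_eq_abs] at hφ
    exact hφ

/-- A commutative Banach algebra generated by `a` is regular if it satisfies a differential
inequality with respect to an embedding into a C*-algebra that has normal values and makes `a`
self-adjoint. No involution on `E` is needed. -/
theorem isRegularBanachAlgebra_of_differential {B : Type*} [NonUnitalCStarAlgebra B]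
    (j : E →ₙₐ[ℂ] B) (hinj : Function.Injective j) (hcomm : ∀ x y : E, x * y = y * x)
    (hnormal : ∀ x, IsStarNormal (j x)) {a : E} (ha : IsSelfAdjoint (j a))
    (hdense : ∀ S : NonUnitalSubalgebra ℂ E, IsClosed (S : Set E) → a ∈ S → S = ⊤)
    {k : ℕ} (hk : 2 ≤ k) {p q C : ℝ} (hp : 0 < p) (hq : 0 < q) (hpq : p + q = k) (hC : 0 < C)
    (h : ∀ x : E, ‖DiffSubalg.posPow x k‖ ≤ C * ‖x‖ ^ p * ‖j x‖ ^ q) :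
    DiffSubalg.IsRegularBanachAlgebra E := by
  have hj : ∀ x, ‖j x‖ ≤ ‖x‖ := fun x => norm_apply_le_of_isStarNormal j (hnormal x)
  obtain ⟨γ, c, hγ0, hγ1, hc, hu⟩ := exists_norm_unitizationExp_le a hk hp.le (by linarith)
    (C := C * 2 ^ q) (by positivity) fun t => by
      refine (h _).trans ?_
      rw [mul_right_comm]
      gcongr
      exact norm_map_expSubOne_le hj ha t
  refine ⟨inferInstance, hcomm, fun x hx => ?_, fun X hX ω hω => ?_⟩
  · apply hinj
    rw [apply_eq_zero_of_forall_character j hcomm (hnormal x) hx, map_zero]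
  · obtain ⟨r, hr, hrX⟩ := exists_dist_le_of_isClosed_characters hdense hX hω
    have hωa : ω a ≠ 0 := by
      -- a character vanishing at the generator vanishes everywhere
      intro h0
      let S : NonUnitalSubalgebra ℂ E :=
        { carrier := {x | ω x = 0}
          mul_mem' := fun {x y} hx hy => by
            rw [Set.mem_ofPred_eq] at *; rw [map_mul, hx, zero_mul]
          add_mem' := fun {x y} hx hy => by
            rw [Set.mem_ofPred_eq] at *; rw [map_add, hx, hy, zero_add]
          zero_mem' := map_zero ω
          smul_mem' := fun c x hx => by
            rw [Set.mem_ofPred_eq] at *; rw [map_smul, hx, smul_zero] }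
      have hS : S = ⊤ := hdense S
        (isClosed_eq (CharacterSpace.toCLM ω).continuous continuous_const) h0
      refine ω.2.1 (ContinuousLinearMap.ext fun x => ?_)
      have : x ∈ S := hS ▸ trivial
      exact this
    obtain ⟨x, hx1, hx0⟩ := exists_bump_of_norm_unitizationExp_le hγ0 hγ1 hu ω hωa hr
    exact ⟨x, fun φ hφ => hx0 φ (hrX φ hφ), by rw [hx1]; exact one_ne_zero⟩

end Differential

end

/-! ### Subalgebras generated by a self-adjoint element -/

/-- In an algebra singly generated by a self-adjoint element every element is normal: it commutes
with everything that commutes with the generator. -/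
theorem isStarNormal_of_mem_elemental {A : Type*} [NonUnitalNormedRing A] [NormedSpace ℂ A]
    [IsScalarTower ℂ A A] [SMulCommClass ℂ A A] [StarRing A] {a : A} (ha : IsSelfAdjoint a)
    {x : A} (hx : x ∈ NonUnitalAlgebra.elemental ℂ a) : IsStarNormal x := by
  have h := NonUnitalAlgebra.elemental.le_centralizer_centralizer (R := ℂ) a hx
  rw [NonUnitalSubalgebra.mem_centralizer_iff] at h
  have hxa : a * x = x * a := by
    refine h a ?_
    rw [SetLike.mem_coe, NonUnitalSubalgebra.mem_centralizer_iff]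
    simp
  refine ⟨h (star x) ?_⟩
  rw [SetLike.mem_coe, NonUnitalSubalgebra.mem_centralizer_iff]
  rintro _ rfl
  simpa [ha.star_eq] using (congrArg star hxa).symm

theorem isRegularBanachAlgebra_elemental {A B : Type u} [NonUnitalNormedRing A] [NormedSpace ℂ A]
    [IsScalarTower ℂ A A] [SMulCommClass ℂ A A] [CompleteSpace A] [StarRing A] [StarModule ℂ A]
    [NonUnitalCStarAlgebra B] {k : ℕ} {p q : ℝ} {ι : A →⋆ₙₐ[ℂ] B}
    (hA : DiffSubalg.IsDifferentialSubalgebra k p q ι) {a : A} (ha : IsSelfAdjoint a) :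
    DiffSubalg.IsRegularBanachAlgebra (NonUnitalAlgebra.elemental ℂ a) := by
  obtain ⟨C, hC, hbound⟩ := hA.bound
  let j : NonUnitalAlgebra.elemental ℂ a →ₙₐ[ℂ] B :=
    (ι : A →ₙₐ[ℂ] B).comp (NonUnitalSubalgebraClass.subtype (NonUnitalAlgebra.elemental ℂ a))
  have hj : ∀ x, j x = ι (x : A) := fun _ => rfl
  have hpow : ∀ (x : NonUnitalAlgebra.elemental ℂ a) (n : ℕ),
      ((DiffSubalg.posPow x n : NonUnitalAlgebra.elemental ℂ a) : A) =
        DiffSubalg.posPow (x : A) n := by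
    intro x n
    induction n with
    | zero => rfl
    | succ n ih =>
      cases n with
      | zero => rfl
      | succ n => rw [DiffSubalg.posPow, DiffSubalg.posPow, ← ih]; rfl
  refine isRegularBanachAlgebra_of_differential (a := ⟨a, NonUnitalAlgebra.elemental.self_mem ℂ a⟩)
    j (hA.injective.comp Subtype.val_injective) (fun x y => mul_comm x y) (fun x => ?_)
    (ha.map ι) (fun S hS haS => ?_) hA.two_le hA.p_pos hA.q_pos hA.add_eq hC fun x => ?_
  · have := isStarNormal_of_mem_elemental ha x.2
    exact this.map ι
  · rw [eq_top_iff]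
    rintro x -
    have hle : NonUnitalAlgebra.elemental ℂ a ≤
        S.map (NonUnitalSubalgebraClass.subtype (NonUnitalAlgebra.elemental ℂ a)) := by
      refine NonUnitalAlgebra.elemental.le_of_mem ?_ ⟨_, haS, rfl⟩
      exact (NonUnitalAlgebra.elemental.isClosedEmbedding_coe ℂ a).isClosedMap _ hS
    obtain ⟨y, hy, hyx⟩ := hle x.2
    rwa [← Subtype.ext hyx]
  · have := hbound (x : A)
    rw [← hpow] at this
    exact this

theorem mainTheorem10 {A B : Type u} [NonUnitalNormedRing A] [NormedSpace ℂ A]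
    [IsScalarTower ℂ A A] [SMulCommClass ℂ A A] [CompleteSpace A] [StarRing A] [StarModule ℂ A]
    [NonUnitalCStarAlgebra B] (k : ℕ) (p q : ℝ) (ι : A →⋆ₙₐ[ℂ] B)
    (hA : DiffSubalg.IsDifferentialSubalgebra k p q ι) :
    DiffSubalg.IsLocallyRegular A ∧
      ∀ a : A, IsSelfAdjoint a →
        DiffSubalg.IsRegularBanachAlgebra (NonUnitalAlgebra.elemental ℂ a) := by
  have key : ∀ a : A, IsSelfAdjoint a →
      DiffSubalg.IsRegularBanachAlgebra (NonUnitalAlgebra.elemental ℂ a) :=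
    fun a ha => isRegularBanachAlgebra_elemental hA ha
  refine ⟨⟨fun a ha => ?_, {a : A | IsSelfAdjoint a}, subset_rfl, subset_closure, key⟩, key⟩
  obtain ⟨H, i₁, i₂, i₃, π, hπ⟩ := NonUnitalCStarAlgebra.exists_representation_ne_zero
    ((map_ne_zero_iff ι hA.injective).2 ha)
  exact ⟨H, i₁, i₂, i₃, π.comp ι, hπ⟩
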